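/- Let $F$ be a field and let $z_1,\dots,z_m$ be nonzero linear forms on $\mathbb{A}^n_F$, i.e. nonzero $F$-linear combinations of the coordinates $x_1,\dots,x_n$. A linear subspace $V\subseteq \mathbb{A}^n_F$ is called special if $V=\bigcap_{i\in S}Z(z_i)$ for some (possibly empty) $S\subseteq\{1,\dots,m\}$; put $S_V=\{i\mid V\subseteq Z(z_i)\}$. For a linear relation $L=\sum_{i=1}^m a_iz_i=0$ among the linear forms $z_1,\dots,z_m$ ($a_i\in F$), let $|L|=\{i\mid a_i\neq 0\}$ and $$P_L=\sum_{i\in|L|}a_i\prod_{k\in |L|\smallsetminus\{i\}}t_k .$$ Dividing by $t_{S_V\cap|L|}=\prod_{j\in S_V\cap |L|}t_j$ and writing $z_j=t_j^{-1}$ for $j\in S_V$, one gets the element $$\frac{P_L}{t_{S_V\cap|L|}}=\sum_{j\in |L|\cap S_V}a_jz_j\prod_{k\in|L|\smallsetminus S_V}t_k+\sum_{i\in |L|\smallsetminus S_V}a_i\prod_{k\in |L|\smallsetminus S_V,\ k\neq i}t_k$$ of the polynomial ring $F[t_i,z_j\mid i\notin S_V,\ j\in S_V]$. Theorem. Let $V$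 be a special subspace of $\mathbb{A}^n_F$. Let $\mathcal{Z}$ be the set of all linear relations among $z_1,\dots,z_m$, and regard $F[z_1,\dots,z_m]$ as a polynomial ring in $m$ variables. Then the kernel of the homomorphism of $F$-algebras $$F[t_i,z_j\mid i\notin S_V,\ j\in S_V]\longrightarrow \Big(\prod_{i\notin S_V}z_i^{-1}\Big)F[z_1,\dots,z_m]/(\mathcal{Z}),\qquad t_i\mapsto z_i^{-1},\quad z_j\mapsto z_j,$$ into the localization of $F[z_1,\dots,z_m]/(\mathcal{Z})$ at the classes of the $z_i$, $i\notin S_V$, is the ideal $\left(\frac{P_L}{t_{S_V\cap|L|}}\right)$ generated by the elements $\frac{P_L}{t_{S_V\cap|L|}}$, where $L$ runs through $\mathcal{Z}$. Moreover, for every $T\subseteq S_V$ the coordinate ring $$\Big(\prod_{j\in T}z_j^{-1}\Big)F[t_i,z_j\mid i\notin S_V,\ j\in S_V]/\Big(\frac{P_L}{t_{S_V\cap|L|}}\Big)$$ of the affine chart $U_{V,T}$ is reduced. -/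

import Mathlib

noncomputable section

namespace ReciprocalPlane

open MvPolynomial

variable {F : Type*} [Field F] {n m : ℕ}

/-- The common zero set `Z(𝒜_S)`, in affine `n`-space, of the linear forms `z i` with `i ∈ S`. -/
def zeroSubspace (z : Fin m → Module.Dual F (Fin n → F)) (S : Set (Fin m)) :
    Submodule F (Fin n → F) :=
  ⨅ i ∈ S, LinearMap.ker (z i)

/-- A subspace is special if it is the common zero set of some (possibly empty) subfamily. -/
def IsSpecial (z : Fin m → Module.Dual F (Fin n → F)) (V : Submodule F (Fin n → F)) : Prop :=
  ∃ S : Set (Fin m), V = zeroSubspace z S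

open scoped Classical in
/-- `S_V`: the indices `i` such that `V` is contained in the zero set of `z i`. -/
def flat (z : Fin m → Module.Dual F (Fin n → F)) (V : Submodule F (Fin n → F)) :
    Finset (Fin m) :=
  {i | V ≤ LinearMap.ker (z i)}

/-- The linear relations `L = ∑ aᵢ zᵢ = 0` among `z 1, …, z m`, given by their coefficients. -/
def relations (z : Fin m → Module.Dual F (Fin n → F)) : Set (Fin m → F) :=
  {a | ∑ i, a i • z i = 0}

open scoped Classical in
/-- `|L|`: the indices that occur in `L` with a nonzero coefficient. -/
def supp (a : Fin m → F) : Finset (Fin m) := {i | a i ≠ 0}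

open scoped Classical in
/-- `P_L = ∑_{i ∈ |L|} aᵢ ∏_{k ∈ |L|, k ≠ i} t_k` in `F[t_1, …, t_m]`. -/
def relPoly (a : Fin m → F) : MvPolynomial (Fin m) F :=
  ∑ i ∈ supp a, C (a i) * ∏ k ∈ (supp a).erase i, X k

/-- The polynomial ring `F[t_i, z_j | i ∉ S, j ∈ S]`. -/
abbrev MixedPoly (F : Type*) [Field F] (S : Finset (Fin m)) : Type _ :=
  MvPolynomial ({i : Fin m // i ∉ S} ⊕ {j : Fin m // j ∈ S}) F

/-- The variable `t_i`, `i ∉ S`. -/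
def tVar (F : Type*) [Field F] (S : Finset (Fin m)) (i : {i : Fin m // i ∉ S}) : MixedPoly F S :=
  X (Sum.inl i)

/-- The variable `z_j`, `j ∈ S`. -/
def zVar (F : Type*) [Field F] (S : Finset (Fin m)) (j : {j : Fin m // j ∈ S}) : MixedPoly F S :=
  X (Sum.inr j)

open scoped Classical in
/-- `P_L / t_{S ∩ |L|}`, as an element of `F[t_i, z_j | i ∉ S, j ∈ S]`, where `t_j = z_j⁻¹` for
`j ∈ S`. Dividing a term of `P_L` by `t_{S ∩ |L|}` leaves
`aⱼ z_j ∏_{k ∈ |L| ∖ S} t_k` for `j ∈ |L| ∩ S` and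
`aᵢ ∏_{k ∈ |L| ∖ S, k ≠ i} t_k` for `i ∈ |L| ∖ S`. -/
def mixedRelPoly (S : Finset (Fin m)) (a : Fin m → F) : MixedPoly F S :=
  (∑ j : {j : Fin m // j ∈ S} with j.1 ∈ supp a,
      C (a j) * zVar F S j * ∏ k : {i : Fin m // i ∉ S} with k.1 ∈ supp a, tVar F S k) +
    ∑ i : {i : Fin m // i ∉ S} with i.1 ∈ supp a,
      C (a i) *
        ∏ k ∈ ({k | k.1 ∈ supp a} : Finset {i : Fin m // i ∉ S}).erase i, tVar F S k

/-- The ideal `(P_L / t_{S ∩ |L|})`, `L` running through all linear relations among the `z i`. -/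
def mixedIdeal (z : Fin m → Module.Dual F (Fin n → F)) (S : Finset (Fin m)) :
    Ideal (MixedPoly F S) :=
  Ideal.span (mixedRelPoly S '' relations z)

/-- `F[z_1, …, z_m]` (polynomial ring in `m` variables) modulo all linear relations among
the linear forms `z i`. -/
abbrev LinearQuot (z : Fin m → Module.Dual F (Fin n → F)) : Type _ :=
  MvPolynomial (Fin m) F ⧸
    Ideal.span ((fun a : Fin m → F => ∑ i, C (a i) * (X i : MvPolynomial (Fin m) F)) '' relations z)

/-- The class of the variable `z_i` in `LinearQuot z`. -/
def zClass (z : Fin m → Module.Dual F (Fin n → F)) (i : Fin m) : LinearQuot z :=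
  Ideal.Quotient.mk _ (X i)

/-- The multiplicative set generated by the classes of the `z_i`, `i ∉ S`. -/
def outerMonoid (z : Fin m → Module.Dual F (Fin n → F)) (S : Finset (Fin m)) :
    Submonoid (LinearQuot z) :=
  Submonoid.closure (zClass z '' {i | i ∉ S})

/-- `LinearQuot z` with the classes of the `z_i`, `i ∉ S`, inverted. -/
abbrev TargetRing (z : Fin m → Module.Dual F (Fin n → F)) (S : Finset (Fin m)) : Type _ :=
  Localization (outerMonoid z S)

/-- The element `z_i⁻¹`, `i ∉ S`, of `TargetRing z S`. -/
def zInv (z : Fin m → Module.Dual F (Fin n → F)) (S : Finset (Fin m))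
    (i : {i : Fin m // i ∉ S}) : TargetRing z S :=
  Localization.mk 1 ⟨zClass z i, Submonoid.subset_closure ⟨i, i.2, rfl⟩⟩

/-- The homomorphism of `F`-algebras with `t_i ↦ z_i⁻¹` for `i ∉ S` and `z_j ↦ z_j` for `j ∈ S`. -/
def chartHom (z : Fin m → Module.Dual F (Fin n → F)) (S : Finset (Fin m)) :
    MixedPoly F S →ₐ[F] TargetRing z S :=
  aeval (Sum.elim (zInv z S) (fun j : {j : Fin m // j ∈ S} =>
    algebraMap (LinearQuot z) (TargetRing z S) (zClass z j)))

/-- The multiplicative set generated by the classes of the variables `z_j`, `j ∈ T`, in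
`F[t_i, z_j | i ∉ S, j ∈ S] / (P_L / t_{S ∩ |L|})`. -/
def innerMonoid (z : Fin m → Module.Dual F (Fin n → F)) (S T : Finset (Fin m)) :
    Submonoid (MixedPoly F S ⧸ mixedIdeal z S) :=
  Submonoid.closure ((fun j => Ideal.Quotient.mk _ (zVar F S j)) '' {j | j.1 ∈ T})

/-- The coordinate ring of the affine chart `U_{V,T}`, `S = S_V`, `T ⊆ S_V`:
the ring `F[t_i, z_j | i ∉ S, j ∈ S] / (P_L / t_{S ∩ |L|})` with the `z_j`, `j ∈ T`, inverted. -/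
abbrev ChartRing (z : Fin m → Module.Dual F (Fin n → F)) (S T : Finset (Fin m)) : Type _ :=
  Localization (innerMonoid z S T)

/-- `mixedRelPoly S a` is the quotient of `P_L` by `t_{S ∩ |L|}` once `t_j = z_j⁻¹` for `j ∈ S`:
this holds in every algebra over `F[t_i, z_j | i ∉ S, j ∈ S]` where the `z_j` are invertible. -/
theorem mixedRelPoly_mul_prod {A : Type*} [CommRing A] [Algebra F A] (S : Finset (Fin m))
    (a : Fin m → F) (f : MixedPoly F S →ₐ[F] A) (t : Fin m → A)
    (ht : ∀ i : {i : Fin m // i ∉ S}, t i = f (tVar F S i))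
    (htz : ∀ j : {j : Fin m // j ∈ S}, t j * f (zVar F S j) = 1) :
    f (mixedRelPoly S a) * ∏ j ∈ S ∩ supp a, t j = aeval t (relPoly a) := by
  classical
  set I : Finset (Fin m) := S ∩ supp a with hI
  set O : Finset (Fin m) := supp a \ S with hO
  have hsplit : supp a = I ∪ O := by ext i; simp [hI, hO]; tauto
  have hdis : Disjoint I O := by
    rw [Finset.disjoint_left]; intro i h1 h2; simp [hI, hO] at h1 h2; exact h2.2 h1.1
  have hOmap : ({k | k.1 ∈ supp a} : Finset {i : Fin m // i ∉ S}).map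
      (Function.Embedding.subtype _) = O := by
    ext i; simp [hO, and_comm]
  have hImap : ({k | k.1 ∈ supp a} : Finset {i : Fin m // i ∈ S}).map
      (Function.Embedding.subtype _) = I := by
    ext i; simp [hI, and_comm]
  have hinner : ∀ j ∈ I, ∏ k ∈ (supp a).erase j, t k = (∏ k ∈ O, t k) * ∏ k ∈ I.erase j, t k := by
    intro j hj
    have hjO : j ∉ O := Finset.disjoint_left.1 hdis hj
    rw [hsplit, Finset.erase_union_distrib, Finset.erase_eq_of_notMem hjO, Finset.prod_union, mul_comm]
    exact hdis.mono_left (Finset.erase_subset _ _)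
  have houter : ∀ i ∈ O, ∏ k ∈ (supp a).erase i, t k = (∏ k ∈ O.erase i, t k) * ∏ k ∈ I, t k := by
    intro i hi
    have hiI : i ∉ I := Finset.disjoint_right.1 hdis hi
    rw [hsplit, Finset.erase_union_distrib, Finset.erase_eq_of_notMem hiI, Finset.prod_union, mul_comm]
    exact hdis.mono_right (Finset.erase_subset _ _)
  have hR : aeval t (relPoly a) =
      (∑ j ∈ I, algebraMap F A (a j) * ((∏ k ∈ O, t k) * ∏ k ∈ I.erase j, t k)) +
        ∑ i ∈ O, algebraMap F A (a i) * ((∏ k ∈ O.erase i, t k) * ∏ k ∈ I, t k) := by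
    have h0 : aeval t (relPoly a) =
        ∑ i ∈ supp a, algebraMap F A (a i) * ∏ k ∈ (supp a).erase i, t k := by
      simp [relPoly, map_sum, map_prod]
    rw [h0]
    conv_lhs => rw [hsplit, Finset.sum_union hdis, ← hsplit]
    congr 1
    · exact Finset.sum_congr rfl fun j hj => by rw [hinner j hj]
    · exact Finset.sum_congr rfl fun j hj => by rw [houter j hj]
  have hC : ∀ c : F, f (C c) = algebraMap F A c := fun c => f.commutes c
  rw [hR, mixedRelPoly, map_add, map_sum, map_sum, add_mul, Finset.sum_mul, Finset.sum_mul,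
    ← hOmap, ← hImap, Finset.sum_map, Finset.sum_map]
  congr 1
  · refine Finset.sum_congr rfl fun j hj => ?_
    have h1 := Finset.mul_prod_erase
      (({k | k.1 ∈ supp a} : Finset {i : Fin m // i ∈ S}).map (Function.Embedding.subtype _)) t
      (Finset.mem_map_of_mem (Function.Embedding.subtype _) hj)
    rw [← h1, Finset.prod_map]
    simp only [map_mul, map_prod, hC, Function.Embedding.subtype_apply, ht]
    linear_combination (algebraMap F A (a j) * (∏ k : {i : Fin m // i ∉ S} with k.1 ∈ supp a,
      f (tVar F S k)) * ∏ k ∈ (({k | k.1 ∈ supp a} : Finset {i : Fin m // i ∈ S}).map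
        (Function.Embedding.subtype _)).erase j.1, t k) * htz j
  · refine Finset.sum_congr rfl fun i hi => ?_
    have h2 := Finset.map_erase (Function.Embedding.subtype fun i : Fin m => i ∉ S)
      ({k | k.1 ∈ supp a} : Finset {i : Fin m // i ∉ S}) i
    simp only [Function.Embedding.subtype_apply] at h2 ⊢
    rw [← h2, Finset.prod_map (Finset.erase _ _)]
    simp only [map_mul, map_prod, hC, Function.Embedding.subtype_apply, ht]
    ring

end ReciprocalPlane

end

/-!
The map `pointHom z S ⊤`, which evaluates at the generic point of the linear space, is the composite
of `chartHom z S` with a map to the field of rational functions. So it suffices to show that its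
kernel is `I = mixedIdeal z S`; this kernel is prime, whence also the reducedness of the charts.

The statement is proved for all strata of the chart at once. Let `y_k` be the class of `z_k` modulo
the span of the `z_j`, `j ∈ S`. For a subspace `W` of the space of these classes, let `J_W`
(`stratumIdeal`) be generated by `I` and the `t_i` with `y_i ∉ W`, and let `K_W` be the kernel of
`pointHom z S W`, where these `t_i` are set to zero. Then `K_W = J_W` (`ker_pointHom`), by
induction on `W`, from four facts.

* The ideals `J_W` and `K_W` agree once the `t_i` with `y_i ∈ W` are inverted, since the relations
  are then linear in the `t_i⁻¹` and the `z_j` (`exists_stratumProd_pow_mul_mem`).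
* For `W' ≤ W` one has `K_W ≤ K_{W'}`, because the generic point of the smaller stratum is the limit
  of an arc in the larger one (`ker_pointHom_mono`).
* Give a monomial as its weight the span of the `y_i` for which `t_i` divides it. In a relation no
  `y_i` is independent of the others, so that all terms of `P_L / t_{S ∩ |L|}` have the same weight,
  and `I` is homogeneous for the grading by the monoid of subspaces under addition
  (`weightedHomogeneousComponent_mem_mixedIdeal`).
* If `y_i` lies in the weight of a monomial, this monomial is divisible by `t_i` modulo `I`
  (`monomial_mem_span_tVar_sup`).

Let `g ∈ K_W`. Its components of weight `W' < W` lie in `I`, by the second fact and the induction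
hypothesis for `W'`; those of weight not contained in `W` lie in `J_W` because of the vanishing
variables; and the one of weight `W` is divisible, modulo `I`, by each `t_i` with `y_i ∈ W`. Hence
`K_W ≤ t_i K_W + J_W` for these `i`. Iterating, `K_W ≤ t ^ r K_W + J_W` for the product `t` of these
variables, and by the first fact and Noetherianity the right-hand side is `J_W` for large `r`.
-/

noncomputable section

namespace ReciprocalPlane

open MvPolynomial

variable {F : Type*} [Field F] {n m : ℕ}

/-! ### The stratification by subspaces of the contracted space of linear forms -/

/-- The space of linear forms modulo the span of the `z j`, `j ∈ S`. -/
abbrev OuterSpace (z : Fin m → Module.Dual F (Fin n → F)) (S : Finset (Fin m)) : Type _ :=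
  Module.Dual F (Fin n → F) ⧸ Submodule.span F (z '' S)

/-- The class of `z i` modulo the span of the `z j`, `j ∈ S`. -/
def outerClass (z : Fin m → Module.Dual F (Fin n → F)) (S : Finset (Fin m)) (i : Fin m) :
    OuterSpace z S :=
  Submodule.Quotient.mk (z i)

/-- The ideal generated by the variables `t_i` with `outerClass z S i ∉ W`. -/
def vanishingIdeal (z : Fin m → Module.Dual F (Fin n → F)) (S : Finset (Fin m))
    (W : Submodule F (OuterSpace z S)) : Ideal (MixedPoly F S) :=
  Ideal.span (X '' (Sum.inl '' {i | outerClass z S i.1 ∉ W}))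

/-- The ideal of the closed stratum attached to `W`: the relations, together with the equations
`t_i = 0` for `outerClass z S i ∉ W`. -/
def stratumIdeal (z : Fin m → Module.Dual F (Fin n → F)) (S : Finset (Fin m))
    (W : Submodule F (OuterSpace z S)) : Ideal (MixedPoly F S) :=
  mixedIdeal z S ⊔ vanishingIdeal z S W

variable {z : Fin m → Module.Dual F (Fin n → F)} {S : Finset (Fin m)}

theorem outerClass_eq_zero {j : Fin m} (hj : j ∈ S) : outerClass z S j = 0 :=
  (Submodule.Quotient.mk_eq_zero _).2 (Submodule.subset_span ⟨j, hj, rfl⟩)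

theorem sum_outerClass {a : Fin m → F} (ha : a ∈ relations z) :
    ∑ i, a i • outerClass z S i = 0 := by
  have h := congrArg (Submodule.mkQ (Submodule.span F (z '' S))) ha
  simpa [map_sum, outerClass] using h

/-- A relation cannot leave the subspace `W` through exactly one of its terms. -/
theorem outerClass_mem_of_relation {a : Fin m → F} (ha : a ∈ relations z)
    {W : Submodule F (OuterSpace z S)} {i : Fin m} (hi : a i ≠ 0)
    (h : ∀ k, k ≠ i → a k ≠ 0 → outerClass z S k ∈ W) : outerClass z S i ∈ W := by
  classical
  have h0 := sum_outerClass (S := S) ha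
  rw [← Finset.add_sum_erase _ _ (Finset.mem_univ i)] at h0
  rw [← Submodule.smul_mem_iff W hi, eq_neg_of_add_eq_zero_left h0]
  refine W.neg_mem (W.sum_mem fun k hk => ?_)
  by_cases hk0 : a k = 0
  · simp [hk0]
  · exact W.smul_mem _ (h k (Finset.ne_of_mem_erase hk) hk0)

theorem tVar_mem_vanishingIdeal {W : Submodule F (OuterSpace z S)} {i : {i : Fin m // i ∉ S}}
    (hi : outerClass z S i.1 ∉ W) : tVar F S i ∈ vanishingIdeal z S W :=
  Ideal.subset_span ⟨_, ⟨i, hi, rfl⟩, rfl⟩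

theorem mem_supp {a : Fin m → F} {i : Fin m} : i ∈ supp a ↔ a i ≠ 0 := by
  simp [supp]

/-- A relation that leaves `W` does so through at least two of its terms, so that each term of
`P_L / t_{S ∩ |L|}` contains a vanishing variable. -/
theorem mixedRelPoly_mem_vanishingIdeal {a : Fin m → F} (ha : a ∈ relations z)
    {W : Submodule F (OuterSpace z S)} {k : Fin m} (hk : a k ≠ 0)
    (hkW : outerClass z S k ∉ W) : mixedRelPoly S a ∈ vanishingIdeal z S W := by
  classical
  have hkS : k ∉ S := fun h => hkW (by rw [outerClass_eq_zero h]; exact W.zero_mem)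
  refine Ideal.add_mem _ (Ideal.sum_mem _ fun j _ => Ideal.mul_mem_left _ _ ?_)
    (Ideal.sum_mem _ fun i hi => Ideal.mul_mem_left _ _ ?_)
  · exact Ideal.mem_of_dvd _ (Finset.dvd_prod_of_mem _
      (by simpa [mem_supp] using hk : (⟨k, hkS⟩ : {i : Fin m // i ∉ S}) ∈ _))
      (tVar_mem_vanishingIdeal hkW)
  · obtain ⟨l, hli, hl, hlW⟩ : ∃ l, l ≠ i.1 ∧ a l ≠ 0 ∧ outerClass z S l ∉ W := by
      by_contra! hcon
      by_cases hki : k = i.1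
      · subst hki
        exact hkW (outerClass_mem_of_relation ha hk hcon)
      · exact hkW (hcon k hki hk)
    have hlS : l ∉ S := fun h => hlW (by rw [outerClass_eq_zero h]; exact W.zero_mem)
    refine Ideal.mem_of_dvd _ (Finset.dvd_prod_of_mem _
      (?_ : (⟨l, hlS⟩ : {i : Fin m // i ∉ S}) ∈ _)) (tVar_mem_vanishingIdeal hlW)
    simpa [Finset.mem_erase, mem_supp, Subtype.ext_iff] using ⟨hli, hl⟩

/-- If `f(t_i) ζ_i = e` and `ζ_j = f(z_j) e` on the support of `a`, then `P_L / t_{S ∩ |L|}` is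
sent, up to the factor `e`, to a multiple of the linear relation between the `ζ_k`. -/
theorem map_mixedRelPoly_mul {A : Type*} [CommRing A] [Algebra F A] (f : MixedPoly F S →ₐ[F] A)
    {e : A} {ζ : Fin m → A} {a : Fin m → F}
    (ht : ∀ i : {i : Fin m // i ∉ S}, a i ≠ 0 → f (tVar F S i) * ζ i = e)
    (hs : ∀ j : {j : Fin m // j ∈ S}, f (zVar F S j) * e = ζ j) :
    open scoped Classical in
    f (mixedRelPoly S a) * e = (∏ k : {i : Fin m // i ∉ S} with k.1 ∈ supp a, f (tVar F S k)) *
      ∑ k, a k • ζ k := by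
  classical
  rw [← Fintype.sum_subtype_add_sum_subtype (fun k => k ∈ S) (fun k => a k • ζ k), mul_add,
    mixedRelPoly, map_add, map_sum, map_sum, add_mul, Finset.sum_mul, Finset.sum_mul,
    Finset.mul_sum, Finset.mul_sum]
  have hC : ∀ c : F, f (C c) = algebraMap F A c := fun c => f.commutes c
  congr 1
  · rw [Finset.sum_filter]
    refine Finset.sum_congr (by ext; simp) fun j _ => ?_
    split_ifs with h
    · simp only [map_mul, map_prod, hC, ← hs j, Algebra.smul_def]
      ring
    · have : a j = 0 := by simpa [mem_supp] using h
      simp [this]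
  · rw [Finset.sum_filter]
    refine Finset.sum_congr rfl fun i _ => ?_
    split_ifs with h
    · rw [← Finset.mul_prod_erase _ _
        (by simpa using h : i ∈ Finset.univ.filter fun k : {i : Fin m // i ∉ S} => k.1 ∈ supp a),
        ← ht i (mem_supp.1 h)]
      simp only [map_mul, map_prod, hC, Algebra.smul_def]
      ring
    · have : a i = 0 := by simpa [mem_supp] using h
      simp [this]

/-- A criterion for a homomorphism to vanish on the ideal of a stratum. With `e = 1` it applies to
points of the stratum; with `e` a uniformizer it applies to arcs leading into a smaller one. -/
theorem stratumIdeal_le_ker {A : Type*} [CommRing A] [Algebra F A] (f : MixedPoly F S →ₐ[F] A)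
    {W : Submodule F (OuterSpace z S)} {e : A} (he : e ∈ nonZeroDivisors A) (ζ : Fin m → A)
    (h0 : ∀ i : {i : Fin m // i ∉ S}, outerClass z S i ∉ W → f (tVar F S i) = 0)
    (ht : ∀ i : {i : Fin m // i ∉ S}, outerClass z S i ∈ W → f (tVar F S i) * ζ i = e)
    (hs : ∀ j : {j : Fin m // j ∈ S}, f (zVar F S j) * e = ζ j)
    (hζ : ∀ a ∈ relations z, ∑ k, a k • ζ k = 0) :
    stratumIdeal z S W ≤ RingHom.ker f := by
  have hvan : vanishingIdeal z S W ≤ RingHom.ker f := by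
    refine Ideal.span_le.2 ?_
    rintro _ ⟨_, ⟨i, hi, rfl⟩, rfl⟩
    exact h0 i hi
  refine sup_le (Ideal.span_le.2 ?_) hvan
  rintro _ ⟨a, ha, rfl⟩
  by_cases hW : ∀ k, a k ≠ 0 → outerClass z S k ∈ W
  · have h := map_mixedRelPoly_mul f (a := a) (fun i hi => ht i (hW i hi)) hs
    rw [hζ a ha, mul_zero] at h
    exact (mul_right_mem_nonZeroDivisors_eq_zero_iff he).1 h
  · push Not at hW
    obtain ⟨k, hk, hkW⟩ := hW
    exact hvan (mixedRelPoly_mem_vanishingIdeal ha hk hkW)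

/-! ### The grading by subspaces -/

/-- The weights of the variables, in the monoid of subspaces under addition: `t_i` has the line of
its class as weight, `z_j` has weight `0`. The weight of a monomial is the span of the classes of
the `t_i` that divide it. -/
def outerWeight (z : Fin m → Module.Dual F (Fin n → F)) (S : Finset (Fin m)) :
    {i : Fin m // i ∉ S} ⊕ {j : Fin m // j ∈ S} → Submodule F (OuterSpace z S) :=
  Sum.elim (fun i => F ∙ outerClass z S i) (fun _ => 0)

theorem finsetSum_submodule_le {ι M : Type*} [AddCommGroup M] [Module F M] {s : Finset ι}
    {p : ι → Submodule F M} {q : Submodule F M} : ∑ i ∈ s, p i ≤ q ↔ ∀ i ∈ s, p i ≤ q := by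
  classical
  induction s using Finset.induction_on with
  | empty => simp
  | insert a s ha ih => simp [Finset.sum_insert ha, Submodule.add_eq_sup, ih]

theorem weight_outerWeight_le_iff {d : {i : Fin m // i ∉ S} ⊕ {j : Fin m // j ∈ S} →₀ ℕ}
    {W : Submodule F (OuterSpace z S)} :
    Finsupp.weight (outerWeight z S) d ≤ W ↔
      ∀ i : {i : Fin m // i ∉ S}, d (Sum.inl i) ≠ 0 → outerClass z S i ∈ W := by
  have hn : ∀ (k : ℕ) (p : Submodule F (OuterSpace z S)), k ≠ 0 → k • p = p := by
    intro k p hk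
    induction k with
    | zero => exact absurd rfl hk
    | succ k ih =>
      rcases eq_or_ne k 0 with rfl | h
      · simp
      · rw [succ_nsmul, ih h, Submodule.add_eq_sup, sup_idem]
  rw [Finsupp.weight_apply, Finsupp.sum, finsetSum_submodule_le]
  constructor
  · intro h i hi
    have := h (Sum.inl i) (by simpa using hi)
    rw [hn _ _ hi] at this
    exact (Submodule.span_singleton_le_iff_mem _ _).1 this
  · rintro h (i | j) hi
    · rw [hn _ _ (by simpa using hi)]
      exact (Submodule.span_singleton_le_iff_mem _ _).2 (h i (by simpa using hi))
    · rw [show outerWeight z S (Sum.inr j) = 0 from rfl, smul_zero]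
      exact bot_le

/-- Leaving out one factor `t_i` with `i ∈ |L|` does not change the weight of a product over
`|L| ∖ S`, since the class of `z_i` is a combination of the others. -/
theorem isWeightedHomogeneous_mixedRelPoly {a : Fin m → F} (ha : a ∈ relations z) :
    ∃ W, IsWeightedHomogeneous (outerWeight z S) (mixedRelPoly S a) W := by
  classical
  set s : Finset {i : Fin m // i ∉ S} := {k | k.1 ∈ supp a} with hs
  have hprod : ∀ s : Finset {i : Fin m // i ∉ S}, IsWeightedHomogeneous (outerWeight z S)
      (∏ k ∈ s, tVar F S k) (∑ k ∈ s, F ∙ outerClass z S k) := fun s =>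
    IsWeightedHomogeneous.prod _ _ _ fun k _ => isWeightedHomogeneous_X F _ _
  refine ⟨∑ k ∈ s, F ∙ outerClass z S k, ?_⟩
  refine IsWeightedHomogeneous.add (IsWeightedHomogeneous.sum _ _ _ fun j hj => ?_)
    (IsWeightedHomogeneous.sum _ _ _ fun i hi => ?_)
  · have hj : IsWeightedHomogeneous (outerWeight z S) (zVar F S j) 0 :=
      isWeightedHomogeneous_X F _ _
    simpa only [zero_add] using (hj.C_mul (a j)).mul (hprod s)
  · have hW : ∑ k ∈ s.erase i, F ∙ outerClass z S k = ∑ k ∈ s, F ∙ outerClass z S k := by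
      rw [← Finset.add_sum_erase s _ hi, Submodule.add_eq_sup, eq_comm, sup_eq_right,
        Submodule.span_singleton_le_iff_mem]
      refine outerClass_mem_of_relation ha (mem_supp.1 (Finset.mem_filter.1 hi).2)
        fun k hki hk => ?_
      by_cases hkS : k ∈ S
      · rw [outerClass_eq_zero hkS]; exact Submodule.zero_mem _
      · have hmem : (⟨k, hkS⟩ : {i : Fin m // i ∉ S}) ∈ s.erase i := by
          simpa [hs, mem_supp, Subtype.ext_iff] using ⟨hki, hk⟩
        exact finsetSum_submodule_le.1 le_rfl _ hmem (Submodule.mem_span_singleton_self _)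
    rw [← hW]
    exact (hprod _).C_mul _

theorem weightedHomogeneousComponent_mem_mixedIdeal {g : MixedPoly F S}
    (hg : g ∈ mixedIdeal z S) (W : Submodule F (OuterSpace z S)) :
    weightedHomogeneousComponent (outerWeight z S) W g ∈ mixedIdeal z S := by
  classical
  let _ := weightedGradedAlgebra F (outerWeight z S)
  refine weightedHomogeneousComponent_mem_of_mem F _ (Ideal.homogeneous_span _ _ ?_) hg W
  rintro _ ⟨a, ha, rfl⟩
  exact isWeightedHomogeneous_mixedRelPoly ha

theorem mem_vanishingIdeal_iff {g : MixedPoly F S} {W : Submodule F (OuterSpace z S)} :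
    g ∈ vanishingIdeal z S W ↔
      ∀ d ∈ g.support, ¬ Finsupp.weight (outerWeight z S) d ≤ W := by
  rw [vanishingIdeal, mem_ideal_span_X_image]
  refine forall₂_congr fun d _ => ?_
  rw [weight_outerWeight_le_iff]
  push Not
  constructor
  · rintro ⟨_, ⟨i, hi, rfl⟩, h⟩
    exact ⟨i, h, hi⟩
  · rintro ⟨i, h, hi⟩
    exact ⟨_, ⟨i, hi, rfl⟩, h⟩

/-- The vanishing variables do not contribute to the component of weight `W`. -/
theorem weightedHomogeneousComponent_mem_of_mem_stratumIdeal {g : MixedPoly F S}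
    {W : Submodule F (OuterSpace z S)} (hg : g ∈ stratumIdeal z S W) :
    weightedHomogeneousComponent (outerWeight z S) W g ∈ mixedIdeal z S := by
  obtain ⟨p, hp, q, hq, rfl⟩ := Submodule.mem_sup.1 hg
  have hq0 : weightedHomogeneousComponent (outerWeight z S) W q = 0 :=
    weightedHomogeneousComponent_eq_zero' _ _ fun d hd h => mem_vanishingIdeal_iff.1 hq d hd h.le
  rw [map_add, hq0, add_zero]
  exact weightedHomogeneousComponent_mem_mixedIdeal hp W

theorem weightedHomogeneousComponent_mem_vanishingIdeal (g : MixedPoly F S)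
    {W W' : Submodule F (OuterSpace z S)} (h : ¬ W' ≤ W) :
    weightedHomogeneousComponent (outerWeight z S) W' g ∈ vanishingIdeal z S W := by
  rw [mem_vanishingIdeal_iff]
  intro d hd
  rwa [weightedHomogeneousComponent_isWeightedHomogeneous W' g (mem_support_iff.1 hd)]

/-- If `z i` is a combination of the `z j`, `j ∈ S`, and of the `z k` for which `t_k` divides a
monomial, then a relation makes this monomial divisible by `t_i`. -/
theorem monomial_mem_span_tVar_sup {d : {i : Fin m // i ∉ S} ⊕ {j : Fin m // j ∈ S} →₀ ℕ} (c : F)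
    {i : {i : Fin m // i ∉ S}}
    (hi : outerClass z S i ∈ Finsupp.weight (outerWeight z S) d) :
    monomial d c ∈ Ideal.span {tVar F S i} ⊔ mixedIdeal z S := by
  classical
  by_cases hdi : d (Sum.inl i) = 0
  swap
  · refine Ideal.mem_sup_left (Ideal.mem_span_singleton.2 ?_)
    exact (X_dvd_monomial.2 (Or.inr hdi))
  -- `P` collects the indices of the variables allowed in an expression of `z i`
  set P : Set (Fin m) := {k | k ∈ S ∨ ∃ h : k ∉ S, d (Sum.inl ⟨k, h⟩) ≠ 0} with hP
  have hiP : i.1 ∉ P := by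
    rintro (h | ⟨h, h'⟩)
    · exact i.2 h
    · exact h' hdi
  have hzi : z i ∈ Submodule.span F (z '' P) := by
    have hle : Finsupp.weight (outerWeight z S) d ≤
        (Submodule.span F (z '' P)).map (Submodule.mkQ (Submodule.span F (z '' S))) :=
      weight_outerWeight_le_iff.2 fun k hk =>
        ⟨z k, Submodule.subset_span ⟨k, Or.inr ⟨k.2, hk⟩, rfl⟩, rfl⟩
    obtain ⟨v, hv, hvi⟩ := hle hi
    have hsub : z i - v ∈ Submodule.span F (z '' S) :=
      (Submodule.Quotient.eq _).1 hvi.symm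
    have h1 : z i - v ∈ Submodule.span F (z '' P) :=
      Submodule.span_mono (Set.image_mono fun j hj => Or.inl hj) hsub
    simpa using add_mem h1 hv
  obtain ⟨c', hc', hc'z⟩ := (Finsupp.mem_span_image_iff_linearCombination F).1 hzi
  have hc'0 : ∀ k, k ∉ P → c' k = 0 := fun k hk => by
    by_contra h
    exact hk (hc' (Finsupp.mem_support_iff.2 h))
  set a : Fin m → F := Pi.single i.1 1 - ⇑c' with ha
  have hai : a i = 1 := by simp [ha, hc'0 _ hiP]
  have hak : ∀ k, k ≠ i.1 → a k ≠ 0 → k ∈ P := fun k hk hk0 => by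
    by_contra h
    exact hk0 (by simp [ha, hc'0 _ h, hk])
  have harel : a ∈ relations z := by
    have h2 : ∑ k, c' k • z k = z i := by
      rw [← hc'z, Finsupp.linearCombination_apply, Finsupp.sum_fintype _ _ (by simp)]
    change ∑ k, a k • z k = 0
    refine LinearMap.ext fun v => ?_
    have h3 : ∑ k, c' k * z k v = z i v := by
      simpa [LinearMap.sum_apply] using LinearMap.congr_fun h2 v
    simp [LinearMap.sum_apply, ha, sub_mul, Finset.sum_sub_distrib, h3, Pi.single_apply]
  set s : Finset {i : Fin m // i ∉ S} := {k | k.1 ∈ supp a} with hs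
  have his : i ∈ s := by simp [hs, mem_supp, hai]
  -- the relation expresses the product of its other `t_k` as a multiple of `t_i`
  have hQ : ∏ k ∈ s.erase i, tVar F S k ∈ Ideal.span {tVar F S i} ⊔ mixedIdeal z S := by
    have hrel : mixedRelPoly S a ∈ Ideal.span {tVar F S i} ⊔ mixedIdeal z S :=
      Ideal.mem_sup_right (Ideal.subset_span ⟨a, harel, rfl⟩)
    rw [mixedRelPoly, ← Finset.add_sum_erase _ _ his, hai, C_1, one_mul] at hrel
    have hdvd : ∀ {r : Finset {i : Fin m // i ∉ S}}, i ∈ r →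
        ∏ k ∈ r, tVar F S k ∈ Ideal.span {tVar F S i} ⊔ mixedIdeal z S := fun h =>
      Ideal.mem_sup_left (Ideal.mem_span_singleton.2 (Finset.dvd_prod_of_mem _ h))
    refine (Ideal.add_mem_iff_left _ ?_).1 ((Ideal.add_mem_iff_right _ ?_).1 hrel)
    · refine Ideal.sum_mem _ fun k hk => Ideal.mul_mem_left _ _ (hdvd ?_)
      exact Finset.mem_erase.2 ⟨(Finset.ne_of_mem_erase hk).symm, his⟩
    · exact Ideal.sum_mem _ fun j _ => Ideal.mul_mem_left _ _ (hdvd his)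
  refine Ideal.mem_of_dvd _ ?_ hQ
  rw [monomial_eq, Finsupp.prod]
  refine Dvd.dvd.mul_left ?_ _
  have hmap : ∏ k ∈ s.erase i, tVar F S k =
      ∏ v ∈ (s.erase i).map Function.Embedding.inl, (X v : MixedPoly F S) := by
    rw [Finset.prod_map]; rfl
  have hsupp : (s.erase i).map Function.Embedding.inl ⊆ d.support := by
    intro v hv
    obtain ⟨k, hk, rfl⟩ := Finset.mem_map.1 hv
    obtain ⟨hki, hk⟩ := Finset.mem_erase.1 hk
    rcases hak k (fun h => hki (Subtype.ext h)) (mem_supp.1 (Finset.mem_filter.1 hk).2) with h | h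
    · exact absurd h k.2
    · simpa using h.2
  rw [hmap]
  refine (Finset.prod_dvd_prod_of_dvd _ _ fun v hv => ?_).trans
    (Finset.prod_dvd_prod_of_subset _ _ _ hsupp)
  exact dvd_pow_self _ (Finsupp.mem_support_iff.1 (hsupp hv))

/-! ### Commutative and linear algebra -/

/-- Over a Noetherian ring, let `J ≤ K` with `K` prime, and suppose that `J` and `K` agree after
inverting the elements `t i`, none of which lies in `K`. If every element of `K` is divisible by
every `t i` modulo `J`, then it is so by any power of their product, with a quotient in `K`, and a
large power sends `K` into `J`; hence `K ≤ J`. -/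
theorem le_of_forall_le_span_singleton_sup {R ι : Type*} [CommRing R] [IsNoetherianRing R]
    {J K : Ideal R} [K.IsPrime] (hJK : J ≤ K) (s : Finset ι) (t : ι → R)
    (ht : ∀ i ∈ s, t i ∉ K) (hdiv : ∀ i ∈ s, K ≤ Ideal.span {t i} ⊔ J)
    (hsat : ∀ g ∈ K, ∃ r : ℕ, (∏ i ∈ s, t i) ^ r * g ∈ J) : K ≤ J := by
  let P : Submonoid R :=
    { carrier := {x | ∀ g ∈ K, ∃ h ∈ K, g - x * h ∈ J}
      one_mem' := fun g hg => ⟨g, hg, by simp⟩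
      mul_mem' := by
        intro x y hx hy g hg
        obtain ⟨h, hh, hgh⟩ := hx g hg
        obtain ⟨h', hh', hgh'⟩ := hy h hh
        refine ⟨h', hh', ?_⟩
        have : g - x * y * h' = (g - x * h) + x * (h - y * h') := by ring
        rw [this]
        exact J.add_mem hgh (J.mul_mem_left _ hgh') }
  have hP : ∏ i ∈ s, t i ∈ P := by
    refine Submonoid.prod_mem _ fun i hi g hg => ?_
    obtain ⟨y, hy, j, hj, rfl⟩ := Submodule.mem_sup.1 (hdiv i hi hg)
    obtain ⟨h, rfl⟩ := Ideal.mem_span_singleton.1 hy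
    refine ⟨h, ?_, by simpa using hj⟩
    exact (‹K.IsPrime›.mem_or_mem ((K.add_mem_iff_left (hJK hj)).1 hg)).resolve_left (ht i hi)
  obtain ⟨G, hG⟩ := IsNoetherian.noetherian K
  have hex : ∀ g : G, ∃ r : ℕ, (∏ i ∈ s, t i) ^ r * g.1 ∈ J := fun g =>
    hsat g (hG ▸ Submodule.subset_span g.2)
  choose r hr using hex
  set x := (∏ i ∈ s, t i) ^ ∑ g, r g with hx
  have hKx : K ≤ Submodule.comap (LinearMap.mulLeft R x) J := by
    conv_lhs => rw [← hG]
    refine Submodule.span_le.2 fun g hg => ?_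
    change x * g ∈ J
    refine Ideal.mem_of_dvd _ (mul_dvd_mul_right (pow_dvd_pow _ ?_) g) (hr ⟨g, hg⟩)
    exact Finset.single_le_sum (f := r) (fun _ _ => Nat.zero_le _) (Finset.mem_univ _)
  intro g hg
  obtain ⟨h, hh, hgh⟩ := (pow_mem hP _ : x ∈ P) g hg
  exact (J.sub_mem_iff_left (hKx hh)).1 hgh

/-- Prescribed values on the vectors `v k`, `k ∈ P`, extend to a linear map as soon as they
satisfy every linear relation among these vectors. -/
theorem exists_linearMap_apply_eq {ι V B : Type*} [Fintype ι] [AddCommGroup V] [Module F V]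
    [AddCommGroup B] [Module F B] (P : Set ι) (v : ι → V) (ζ : ι → B)
    (h : ∀ a : ι → F, (∀ k ∉ P, a k = 0) → ∑ k, a k • v k = 0 → ∑ k, a k • ζ k = 0) :
    ∃ f : V →ₗ[F] B, ∀ k ∈ P, f (v k) = ζ k := by
  classical
  let E : Submodule F (ι → F) := ⨅ k ∈ Pᶜ, LinearMap.ker (LinearMap.proj k)
  have hE : ∀ a : ι → F, a ∈ E ↔ ∀ k ∉ P, a k = 0 := by
    intro a; simp [E, Submodule.mem_iInf]
  let p : E →ₗ[F] V := (Fintype.linearCombination F v).domRestrict E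
  let q : E →ₗ[F] B := (Fintype.linearCombination F ζ).domRestrict E
  have hpq : LinearMap.ker p ≤ LinearMap.ker q := fun a ha =>
    h a.1 ((hE _).1 a.2) (by simpa [p, Fintype.linearCombination_apply] using ha)
  obtain ⟨f, hf⟩ := ((LinearMap.ker p).liftQ q hpq ∘ₗ
    p.quotKerEquivRange.symm.toLinearMap).exists_extend
  refine ⟨f, fun k hk => ?_⟩
  let e : E := ⟨Pi.single k 1, (hE _).2 fun l hl =>
    Pi.single_eq_of_ne (by rintro rfl; exact hl hk) _⟩
  have hpe : p e = v k := by simp [p, e, Fintype.linearCombination_apply_single]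
  have hqe : q e = ζ k := by simp [q, e, Fintype.linearCombination_apply_single]
  have h1 := LinearMap.congr_fun hf ⟨p e, LinearMap.mem_range_self p e⟩
  have h2 : p.quotKerEquivRange.symm ⟨p e, LinearMap.mem_range_self p e⟩ =
      Submodule.Quotient.mk e := by
    rw [LinearEquiv.symm_apply_eq]; rfl
  rw [LinearMap.comp_apply, LinearMap.comp_apply, LinearEquiv.coe_coe, h2,
    Submodule.liftQ_apply, hqe] at h1
  rw [← hpe, ← h1]
  rfl

/-! ### Generic points of the strata -/

/-- A linear form, as a polynomial of degree one in the coordinates. -/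
def linearForm (F : Type*) [Field F] (n : ℕ) :
    Module.Dual F (Fin n → F) →ₗ[F] MvPolynomial (Fin n) F where
  toFun f := ∑ l, f (Pi.single l 1) • X l
  map_add' f g := by simp [add_smul, Finset.sum_add_distrib]
  map_smul' c f := by simp [mul_smul, Finset.smul_sum]

theorem linearForm_apply (f : Module.Dual F (Fin n → F)) :
    linearForm F n f = ∑ l, f (Pi.single l 1) • X l := rfl

theorem linearForm_ne_zero {f : Module.Dual F (Fin n → F)} (hf : f ≠ 0) :
    linearForm F n f ≠ 0 := by
  classical
  contrapose! hf
  refine LinearMap.pi_ext' fun l => LinearMap.ext_ring ?_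
  have := congrArg (coeff (Finsupp.single l 1)) hf
  simpa [linearForm_apply, coeff_sum, coeff_X, Finsupp.single_left_inj] using this

/-- The field of rational functions on affine `n`-space. -/
abbrev RatFun (F : Type*) [Field F] (n : ℕ) : Type _ := FractionRing (MvPolynomial (Fin n) F)

/-- A linear form, as a rational function. -/
def ratForm (F : Type*) [Field F] (n : ℕ) : Module.Dual F (Fin n → F) →ₗ[F] RatFun F n :=
  (IsScalarTower.toAlgHom F (MvPolynomial (Fin n) F) (RatFun F n)).toLinearMap ∘ₗ linearForm F n

theorem ratForm_apply (f : Module.Dual F (Fin n → F)) :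
    ratForm F n f = algebraMap _ _ (linearForm F n f) := rfl

theorem ratForm_ne_zero {f : Module.Dual F (Fin n → F)} (hf : f ≠ 0) : ratForm F n f ≠ 0 := by
  rw [ratForm_apply, Ne, FaithfulSMul.algebraMap_eq_zero_iff]
  exact linearForm_ne_zero hf

theorem sum_smul_map_eq_zero {z : Fin m → Module.Dual F (Fin n → F)} {B : Type*} [AddCommGroup B]
    [Module F B] (f : Module.Dual F (Fin n → F) →ₗ[F] B) {a : Fin m → F} (ha : a ∈ relations z) :
    ∑ k, a k • f (z k) = 0 := by
  have h := congrArg f ha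
  simpa only [map_sum, map_smul, map_zero] using h

open scoped Classical in
/-- The generic point of the stratum of `W`: `t_i` is sent to `z_i⁻¹` or to `0`, according as the
class of `z_i` lies in `W` or not, and `z_j` to `z_j`. -/
def pointHom (z : Fin m → Module.Dual F (Fin n → F)) (S : Finset (Fin m))
    (W : Submodule F (OuterSpace z S)) : MixedPoly F S →ₐ[F] RatFun F n :=
  aeval (Sum.elim (fun i => if outerClass z S i ∈ W then (ratForm F n (z i))⁻¹ else 0)
    (fun j => ratForm F n (z j)))

open scoped Classical in
/-- The product of the variables `t_i` that do not vanish on the stratum of `W`. -/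
def stratumProd (z : Fin m → Module.Dual F (Fin n → F)) (S : Finset (Fin m))
    (W : Submodule F (OuterSpace z S)) : MixedPoly F S :=
  ∏ i : {i : Fin m // i ∉ S} with outerClass z S i.1 ∈ W, tVar F S i

theorem pointHom_tVar_of_mem {W : Submodule F (OuterSpace z S)} {i : {i : Fin m // i ∉ S}}
    (hi : outerClass z S i ∈ W) : pointHom z S W (tVar F S i) = (ratForm F n (z i))⁻¹ := by
  simp [pointHom, tVar, hi]

theorem pointHom_tVar_of_notMem {W : Submodule F (OuterSpace z S)} {i : {i : Fin m // i ∉ S}}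
    (hi : outerClass z S i ∉ W) : pointHom z S W (tVar F S i) = 0 := by
  simp [pointHom, tVar, hi]

theorem pointHom_zVar {W : Submodule F (OuterSpace z S)} (j : {j : Fin m // j ∈ S}) :
    pointHom z S W (zVar F S j) = ratForm F n (z j) := by
  simp [pointHom, zVar]

theorem stratumIdeal_le_ker_pointHom (hz : ∀ i, z i ≠ 0) (W : Submodule F (OuterSpace z S)) :
    stratumIdeal z S W ≤ RingHom.ker (pointHom z S W) :=
  stratumIdeal_le_ker _ (one_mem _) (fun k => ratForm F n (z k))
    (fun _ hi => pointHom_tVar_of_notMem hi)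
    (fun i hi => by rw [pointHom_tVar_of_mem hi, inv_mul_cancel₀ (ratForm_ne_zero (hz i))])
    (fun j => by rw [pointHom_zVar, mul_one]) fun _ ha => sum_smul_map_eq_zero _ ha

/-- `pointHom` is universal among the homomorphisms that send the `t_i` to `0` or to the inverse
of `z_i`, as prescribed by `W`, and `z_j` to `z_j`, for linear forms with values in any algebra. -/
theorem map_eq_zero_of_pointHom_eq_zero (hz : ∀ i, z i ≠ 0) {W : Submodule F (OuterSpace z S)}
    {B : Type*} [CommRing B] [Algebra F B] (τ : MixedPoly F S →ₐ[F] B)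
    (ρ : MvPolynomial (Fin n) F →ₐ[F] B)
    (h0 : ∀ i : {i : Fin m // i ∉ S}, outerClass z S i ∉ W → τ (tVar F S i) = 0)
    (ht : ∀ i : {i : Fin m // i ∉ S}, outerClass z S i ∈ W →
      τ (tVar F S i) * ρ (linearForm F n (z i)) = 1)
    (hs : ∀ j : {j : Fin m // j ∈ S}, τ (zVar F S j) = ρ (linearForm F n (z j)))
    {g : MixedPoly F S} (hg : pointHom z S W g = 0) : τ g = 0 := by
  classical
  let d : MvPolynomial (Fin n) F :=
    ∏ i : {i : Fin m // i ∉ S} with outerClass z S i.1 ∈ W, linearForm F n (z i)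
  have hd : τ (stratumProd z S W) * ρ d = 1 := by
    simp only [stratumProd, d, map_prod, ← Finset.prod_mul_distrib]
    exact Finset.prod_eq_one fun i hi => ht i (Finset.mem_filter.1 hi).2
  -- both `pointHom` and `τ` factor through fractions with denominator a power of `d`
  have key : ∀ p : MixedPoly F S, ∃ (r : ℕ) (h : MvPolynomial (Fin n) F),
      algebraMap _ (RatFun F n) h = pointHom z S W p * algebraMap _ _ d ^ r ∧
        ρ h = τ p * ρ d ^ r := by
    intro p
    induction p using MvPolynomial.induction_on with
    | C c =>
      refine ⟨0, C c, ?_, ?_⟩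
      · simpa [algebraMap_eq] using
          (IsScalarTower.algebraMap_apply F (MvPolynomial (Fin n) F) (RatFun F n) c).symm.trans
            ((pointHom z S W).commutes c).symm
      · simp
    | add p q hp hq =>
      obtain ⟨r, h, h1, h2⟩ := hp
      obtain ⟨r', h', h1', h2'⟩ := hq
      refine ⟨r + r', h * d ^ r' + h' * d ^ r, ?_, ?_⟩
      · rw [map_add, map_mul, map_mul, map_pow, map_pow, h1, h1', map_add]; ring
      · rw [map_add, map_mul, map_mul, map_pow, map_pow, h2, h2', map_add]; ring
    | mul_X p v hp =>
      obtain ⟨r, h, h1, h2⟩ := hp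
      rcases v with i | j
      · by_cases hi : outerClass z S i ∈ W
        · have his : i ∈ (Finset.univ.filter fun i : {i : Fin m // i ∉ S} =>
              outerClass z S i ∈ W) := by simpa using hi
          have hdi := Finset.mul_prod_erase _ (fun i : {i : Fin m // i ∉ S} =>
            linearForm F n (z i)) his
          set d' := ∏ k ∈ (Finset.univ.filter fun i : {i : Fin m // i ∉ S} =>
              outerClass z S i ∈ W).erase i, linearForm F n (z k)
          have hdd : d = linearForm F n (z i) * d' := hdi.symm
          refine ⟨r + 1, h * d', ?_, ?_⟩
          · have ht : pointHom z S W (X (Sum.inl i)) = (ratForm F n (z i))⁻¹ :=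
              pointHom_tVar_of_mem hi
            have h0 : (ratForm F n (z i))⁻¹ * ratForm F n (z i) = 1 :=
              inv_mul_cancel₀ (ratForm_ne_zero (hz i))
            rw [map_mul, map_mul, h1, ht, pow_succ]
            nth_rw 3 [hdd]
            rw [map_mul, ← ratForm_apply]
            linear_combination (-pointHom z S W p * algebraMap _ _ d ^ r * algebraMap _ _ d') * h0
          · have h1 : τ (X (Sum.inl i)) * ρ (linearForm F n (z i)) = 1 := ht i hi
            rw [map_mul, map_mul, h2, pow_succ]
            nth_rw 3 [hdd]
            rw [map_mul]
            linear_combination (-τ p * ρ d ^ r * ρ d') * h1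
        · refine ⟨r, 0, ?_, ?_⟩
          · have ht : pointHom z S W (X (Sum.inl i)) = 0 := pointHom_tVar_of_notMem hi
            simp [ht]
          · have ht : τ (X (Sum.inl i)) = 0 :=
              h0 i hi
            simp [ht]
      · refine ⟨r, h * linearForm F n (z j), ?_, ?_⟩
        · have ht : pointHom z S W (X (Sum.inr j)) = ratForm F n (z j) := pointHom_zVar j
          rw [map_mul, map_mul, h1, ht, ratForm_apply]; ring
        · have h0 : τ (X (Sum.inr j)) = ρ (linearForm F n (z j)) := hs j
          rw [map_mul, map_mul, h2, h0]; ring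
  obtain ⟨r, h, h1, h2⟩ := key g
  rw [hg, zero_mul, FaithfulSMul.algebraMap_eq_zero_iff] at h1
  rw [h1, map_zero] at h2
  calc τ g = τ (stratumProd z S W) ^ r * (τ g * ρ d ^ r) := by
        rw [mul_left_comm, ← mul_pow, hd, one_pow, mul_one]
    _ = 0 := by rw [← h2, mul_zero]

/-- On the open part of a stratum, where the remaining `t_i` are invertible, the relations become
linear in the `t_i⁻¹` and the `z_j`, so that they cut out the generic point. -/
theorem exists_stratumProd_pow_mul_mem (hz : ∀ i, z i ≠ 0) {W : Submodule F (OuterSpace z S)}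
    {g : MixedPoly F S} (hg : g ∈ RingHom.ker (pointHom z S W)) :
    ∃ r : ℕ, stratumProd z S W ^ r * g ∈ stratumIdeal z S W := by
  classical
  let x : MixedPoly F S ⧸ stratumIdeal z S W := Ideal.Quotient.mk _ (stratumProd z S W)
  let B := Localization.Away x
  let τ : MixedPoly F S →ₐ[F] B :=
    (IsScalarTower.toAlgHom F (MixedPoly F S ⧸ stratumIdeal z S W) B).comp
      (Ideal.Quotient.mkₐ F (stratumIdeal z S W))
  have hτ : ∀ p ∈ stratumIdeal z S W, τ p = 0 := fun p hp => by
    change algebraMap _ B (Ideal.Quotient.mk (stratumIdeal z S W) p) = 0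
    rw [Ideal.Quotient.eq_zero_iff_mem.2 hp, map_zero]
  have hunit : IsUnit (τ (stratumProd z S W)) := IsLocalization.Away.algebraMap_isUnit x
  have hunit' : ∀ i : {i : Fin m // i ∉ S}, outerClass z S i ∈ W → IsUnit (τ (tVar F S i)) :=
    fun i hi => isUnit_of_dvd_unit
      (map_dvd τ (Finset.dvd_prod_of_mem (tVar F S) (by simpa using hi))) hunit
  -- the values in `B` that the linear forms `z k` should take
  let ζ : Fin m → B := fun k =>
    if h : k ∈ S then τ (zVar F S ⟨k, h⟩) else Ring.inverse (τ (tVar F S ⟨k, h⟩))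
  have hζs : ∀ j : {j : Fin m // j ∈ S}, τ (zVar F S j) * 1 = ζ j := fun j => by
    simp [ζ, j.2]
  have hζt : ∀ i : {i : Fin m // i ∉ S}, outerClass z S i ∈ W → τ (tVar F S i) * ζ i = 1 :=
    fun i hi => by
      simp only [ζ, i.2, dite_false]
      exact Ring.mul_inverse_cancel _ (hunit' i hi)
  obtain ⟨f, hf⟩ := exists_linearMap_apply_eq (F := F) {k | outerClass z S k ∈ W} z ζ
    (by
      intro a haW ha
      have haW' : ∀ k, a k ≠ 0 → outerClass z S k ∈ W := fun k hk => by
        by_contra h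
        exact hk (haW k h)
      have h := map_mixedRelPoly_mul τ (a := a) (fun i hi => hζt i (haW' i hi)) hζs
      rw [hτ _ (Ideal.mem_sup_left (Ideal.subset_span ⟨a, ha, rfl⟩)), zero_mul] at h
      refine ((IsUnit.mul_right_eq_zero ?_).1 h.symm)
      exact IsUnit.prod_iff.2 fun k hk =>
        hunit' k (haW' k (mem_supp.1 (Finset.mem_filter.1 hk).2)))
  let ρ : MvPolynomial (Fin n) F →ₐ[F] B := aeval fun l => f (LinearMap.proj l)
  have hρ : ∀ v, ρ (linearForm F n v) = f v := fun v => by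
    have hv : v = ∑ l, v (Pi.single l 1) • LinearMap.proj l := by
      refine LinearMap.pi_ext' fun k => LinearMap.ext_ring ?_
      simp [Pi.single_apply]
    conv_rhs => rw [hv]
    simp [linearForm_apply, ρ, map_sum]
  have hτg : τ g = 0 := map_eq_zero_of_pointHom_eq_zero hz τ ρ
    (fun i hi => hτ _ (Ideal.mem_sup_right (tVar_mem_vanishingIdeal hi)))
    (fun i hi => by rw [hρ, hf _ hi, hζt i hi])
    (fun j => by
      rw [hρ, hf _ (by simp [outerClass_eq_zero j.2]), ← hζs j, mul_one]) hg
  obtain ⟨⟨_, k, rfl⟩, hk⟩ := (IsLocalization.map_eq_zero_iff (Submonoid.powers x) B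
    (Ideal.Quotient.mk _ g)).1 hτg
  refine ⟨k, Ideal.Quotient.eq_zero_iff_mem.1 ?_⟩
  rw [map_mul, map_pow]
  exact hk

/-! ### Arcs from a stratum into a smaller one -/

/-- The linear map `f ↦ p(f) + f ε` into power series in `ε`, for an endomorphism `p` of the space
of linear forms. -/
def arcForm (p : Module.Dual F (Fin n → F) →ₗ[F] Module.Dual F (Fin n → F)) :
    Module.Dual F (Fin n → F) →ₗ[F] PowerSeries (RatFun F n) :=
  (IsScalarTower.toAlgHom F (RatFun F n) (PowerSeries (RatFun F n))).toLinearMap ∘ₗ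
      ratForm F n ∘ₗ p +
    LinearMap.mulLeft F PowerSeries.X ∘ₗ
      (IsScalarTower.toAlgHom F (RatFun F n) (PowerSeries (RatFun F n))).toLinearMap ∘ₗ ratForm F n

theorem arcForm_apply (p : Module.Dual F (Fin n → F) →ₗ[F] Module.Dual F (Fin n → F))
    (f : Module.Dual F (Fin n → F)) :
    arcForm p f = PowerSeries.C (ratForm F n (p f)) +
      PowerSeries.X * PowerSeries.C (ratForm F n f) := rfl

/-- The generic point of the stratum of `W'` is a specialization of that of a larger `W`: let `p`
be an endomorphism of the space of linear forms with kernel the preimage of `W'`. The arc along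
which `z_k` takes the value `z_k + p(z_k) ε⁻¹` lies in the stratum of `W`, and its limit for
`ε → 0` is the generic point of the stratum of `W'`. -/
theorem ker_pointHom_mono (hz : ∀ i, z i ≠ 0) {W W' : Submodule F (OuterSpace z S)}
    (hW : W' ≤ W) : RingHom.ker (pointHom z S W) ≤ RingHom.ker (pointHom z S W') := by
  classical
  let K := W'.comap (Submodule.mkQ (Submodule.span F (z '' S)))
  obtain ⟨q, hq⟩ := K.mkQ.exists_rightInverse_of_surjective K.range_mkQ
  let p : Module.Dual F (Fin n → F) →ₗ[F] Module.Dual F (Fin n → F) := q ∘ₗ K.mkQ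
  have hp : ∀ i, p (z i) = 0 ↔ outerClass z S i ∈ W' := fun i => by
    have hinj : Function.Injective q :=
      Function.LeftInverse.injective (g := K.mkQ) fun x => LinearMap.congr_fun hq x
    change q (K.mkQ (z i)) = 0 ↔ z i ∈ K
    rw [map_eq_zero_iff q hinj, Submodule.mkQ_apply, Submodule.Quotient.mk_eq_zero]
  have hconst : ∀ i, outerClass z S i ∉ W' →
      PowerSeries.constantCoeff (arcForm p (z i)) ≠ 0 := fun i hi => by
    simpa [arcForm_apply] using ratForm_ne_zero (mt (hp i).1 hi)
  let ψ : MixedPoly F S →ₐ[F] PowerSeries (RatFun F n) :=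
    aeval (Sum.elim
      (fun i => if outerClass z S i.1 ∈ W' then PowerSeries.C (ratForm F n (z i))⁻¹
        else if outerClass z S i.1 ∈ W then PowerSeries.X * (arcForm p (z i))⁻¹ else 0)
      (fun j => PowerSeries.C (ratForm F n (z j))))
  have hψt : ∀ i : {i : Fin m // i ∉ S}, outerClass z S i ∈ W →
      ψ (tVar F S i) * arcForm p (z i) = PowerSeries.X := fun i hi => by
    by_cases hi' : outerClass z S i ∈ W'
    · have h1 : (PowerSeries.C (ratForm F n (z i))⁻¹ : PowerSeries (RatFun F n)) *
          PowerSeries.C (ratForm F n (z i)) = 1 := by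
        rw [← map_mul, inv_mul_cancel₀ (ratForm_ne_zero (hz i)), map_one]
      simp only [ψ, tVar, aeval_X, Sum.elim_inl, hi', if_true, arcForm_apply, (hp i).2 hi', map_zero,
        zero_add]
      rw [mul_left_comm, h1, mul_one]
    · simp only [ψ, tVar, aeval_X, Sum.elim_inl, hi', hi, if_true, if_false]
      rw [mul_assoc, PowerSeries.inv_mul_cancel _ (hconst i hi'), mul_one]
  have hker : stratumIdeal z S W ≤ RingHom.ker ψ := by
    refine stratumIdeal_le_ker ψ (mem_nonZeroDivisors_of_ne_zero PowerSeries.X_ne_zero)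
      (fun k => arcForm p (z k)) (fun i hi => ?_) hψt (fun j => ?_)
      (fun a ha => sum_smul_map_eq_zero _ ha)
    · simp [ψ, tVar, hi, mt (@hW _) hi]
    · have hj : p (z j) = 0 := (hp j).2 (by simp [outerClass_eq_zero j.2])
      simp [ψ, zVar, arcForm_apply, hj, mul_comm]
  have hlim : ∀ g, PowerSeries.constantCoeff (ψ g) = pointHom z S W' g := by
    intro g
    suffices h : PowerSeries.constantCoeff.comp (ψ : MixedPoly F S →+* _) =
        (pointHom z S W' : MixedPoly F S →+* RatFun F n) from RingHom.congr_fun h g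
    refine ringHom_ext (fun c => ?_) ?_
    · simp [ψ, pointHom, PowerSeries.algebraMap_apply]
    · rintro (i | j)
      · by_cases hi' : outerClass z S i ∈ W'
        · simp [ψ, pointHom, hi']
        · by_cases hi : outerClass z S i ∈ W <;> simp [ψ, pointHom, hi', hi]
      · simp [ψ, pointHom]
  intro g hg
  obtain ⟨r, hr⟩ := exists_stratumProd_pow_mul_mem hz hg
  have h0 : ψ (stratumProd z S W) ≠ 0 := by
    rw [stratumProd, map_prod, Finset.prod_ne_zero_iff]
    intro i hi h
    have := hψt i (Finset.mem_filter.1 hi).2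
    rw [h, zero_mul] at this
    exact PowerSeries.X_ne_zero this.symm
  have hg0 : ψ g = 0 := by
    have := RingHom.mem_ker.1 (hker hr)
    rw [map_mul, map_pow] at this
    exact (mul_eq_zero.1 this).resolve_left (pow_ne_zero _ h0)
  rw [RingHom.mem_ker, ← hlim, hg0, map_zero]

/-! ### The ideal of a stratum is the ideal of its generic point -/

/-- The inductive step: modulo the ideal of the stratum, only the component of weight `W` of an
element of the kernel survives, and it is divisible by `t_i`. -/
theorem ker_pointHom_le_span_tVar_sup (hz : ∀ i, z i ≠ 0) {W : Submodule F (OuterSpace z S)}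
    (ih : ∀ W' < W, RingHom.ker (pointHom z S W') ≤ stratumIdeal z S W')
    {i : {i : Fin m // i ∉ S}} (hi : outerClass z S i ∈ W) :
    RingHom.ker (pointHom z S W) ≤ Ideal.span {tVar F S i} ⊔ stratumIdeal z S W := by
  intro g hg
  rw [← sum_weightedHomogeneousComponent (outerWeight z S) g,
    finsum_eq_sum _ (weightedHomogeneousComponent_finsupp g)]
  refine Ideal.sum_mem _ fun W' _ => ?_
  by_cases hle : W' ≤ W
  swap
  · exact Ideal.mem_sup_right
      (Ideal.mem_sup_right (weightedHomogeneousComponent_mem_vanishingIdeal g hle))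
  rcases hle.lt_or_eq with hlt | rfl
  · exact Ideal.mem_sup_right (Ideal.mem_sup_left
      (weightedHomogeneousComponent_mem_of_mem_stratumIdeal
        (ih W' hlt (ker_pointHom_mono hz hle hg))))
  · have hsup : Ideal.span {tVar F S i} ⊔ mixedIdeal z S ≤
        Ideal.span {tVar F S i} ⊔ stratumIdeal z S W' := sup_le_sup_left le_sup_left _
    rw [as_sum (weightedHomogeneousComponent (outerWeight z S) W' g)]
    refine Ideal.sum_mem _ fun d hd => hsup (monomial_mem_span_tVar_sup _ ?_)
    rwa [weightedHomogeneousComponent_isWeightedHomogeneous W' g (mem_support_iff.1 hd)]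

theorem ker_pointHom (hz : ∀ i, z i ≠ 0) (W : Submodule F (OuterSpace z S)) :
    RingHom.ker (pointHom z S W) = stratumIdeal z S W := by
  classical
  refine le_antisymm ?_ (stratumIdeal_le_ker_pointHom hz W)
  induction W using WellFoundedLT.induction with
  | ind W ih =>
    have : (RingHom.ker (pointHom z S W)).IsPrime := RingHom.ker_isPrime _
    refine le_of_forall_le_span_singleton_sup (stratumIdeal_le_ker_pointHom hz W)
      (Finset.univ.filter fun i : {i : Fin m // i ∉ S} => outerClass z S i.1 ∈ W) (tVar F S)
      (fun i hi => ?_) (fun i hi => ?_) fun g hg => ?_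
    · rw [RingHom.mem_ker, pointHom_tVar_of_mem (Finset.mem_filter.1 hi).2]
      exact inv_ne_zero (ratForm_ne_zero (hz i))
    · exact ker_pointHom_le_span_tVar_sup hz ih (Finset.mem_filter.1 hi).2
    · obtain ⟨r, hr⟩ := exists_stratumProd_pow_mul_mem hz hg
      exact ⟨r, hr⟩

theorem ker_pointHom_top (hz : ∀ i, z i ≠ 0) :
    RingHom.ker (pointHom z S ⊤) = mixedIdeal z S := by
  rw [ker_pointHom hz, stratumIdeal, vanishingIdeal]
  simp

theorem isPrime_mixedIdeal (hz : ∀ i, z i ≠ 0) : (mixedIdeal z S).IsPrime := by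
  rw [← ker_pointHom_top hz]
  exact RingHom.ker_isPrime _

/-! ### The chart -/

theorem zInv_mul_zClass (i : {i : Fin m // i ∉ S}) :
    zInv z S i * algebraMap (LinearQuot z) (TargetRing z S) (zClass z i) = 1 := by
  have h := IsLocalization.mk'_spec (TargetRing z S) (1 : LinearQuot z)
    (⟨zClass z i, Submonoid.subset_closure ⟨i, i.2, rfl⟩⟩ : outerMonoid z S)
  rw [← Localization.mk_eq_mk'_apply, map_one] at h
  exact h

theorem sum_smul_zClass {a : Fin m → F} (ha : a ∈ relations z) :
    ∑ k, a k • zClass z k = 0 := by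
  have hmem : ∑ i, C (a i) * (X i : MvPolynomial (Fin m) F) ∈ Ideal.span
      ((fun a : Fin m → F => ∑ i, C (a i) * (X i : MvPolynomial (Fin m) F)) '' relations z) :=
    Ideal.subset_span ⟨a, ha, rfl⟩
  rw [← Ideal.Quotient.eq_zero_iff_mem, map_sum] at hmem
  rw [← hmem]
  refine Finset.sum_congr rfl fun k _ => ?_
  rw [← smul_eq_C_mul]
  rfl

theorem mixedIdeal_le_ker_chartHom : mixedIdeal z S ≤ RingHom.ker (chartHom z S) := by
  refine Ideal.span_le.2 ?_
  rintro _ ⟨a, ha, rfl⟩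
  have h := map_mixedRelPoly_mul (chartHom z S) (e := 1) (a := a)
    (ζ := fun k => algebraMap (LinearQuot z) (TargetRing z S) (zClass z k))
    (fun i _ => by simpa [chartHom, tVar] using zInv_mul_zClass i)
    (fun j => by simp [chartHom, zVar])
  have h' := congrArg (IsScalarTower.toAlgHom F (LinearQuot z) (TargetRing z S))
    (sum_smul_zClass ha)
  simp only [map_sum, map_smul, map_zero, IsScalarTower.coe_toAlgHom'] at h'
  rw [h', mul_zero, mul_one] at h
  exact h

theorem ker_chartHom_le (hz : ∀ i, z i ≠ 0) :
    RingHom.ker (chartHom z S) ≤ RingHom.ker (pointHom z S ⊤) := by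
  let ev : LinearQuot z →ₐ[F] RatFun F n := Ideal.Quotient.liftₐ _
    (aeval fun k => ratForm F n (z k)) (by
      refine fun p hp => RingHom.mem_ker.1 ((Ideal.span_le.2 ?_ : _ ≤ RingHom.ker
        (aeval fun k => ratForm F n (z k) : MvPolynomial (Fin m) F →ₐ[F] RatFun F n)) hp)
      rintro _ ⟨a, ha, rfl⟩
      have h := sum_smul_map_eq_zero (ratForm F n) ha
      simpa [RingHom.mem_ker, Algebra.smul_def] using h)
  have hev : ∀ k, ev (zClass z k) = ratForm F n (z k) := fun k => by
    change (aeval fun k => ratForm F n (z k)) (X k : MvPolynomial (Fin m) F) = _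
    simp
  have hunit : ∀ y : outerMonoid z S, IsUnit (ev y) := by
    have hle : outerMonoid z S ≤ (IsUnit.submonoid (RatFun F n)).comap (ev : LinearQuot z →* _) := by
      refine Submonoid.closure_le.2 ?_
      rintro _ ⟨i, -, rfl⟩
      change IsUnit (ev (zClass z i))
      rw [hev]
      exact (ratForm_ne_zero (hz i)).isUnit
    exact fun y => hle y.2
  let φ : TargetRing z S →+* RatFun F n :=
    IsLocalization.lift (M := outerMonoid z S) (S := TargetRing z S)
      (g := (ev : LinearQuot z →+* RatFun F n)) hunit
  have hφ : ∀ x, φ (algebraMap (LinearQuot z) (TargetRing z S) x) = ev x := fun x =>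
    IsLocalization.lift_eq _ x
  have hcomp : φ.comp (chartHom z S : MixedPoly F S →+* TargetRing z S) =
      (pointHom z S ⊤ : MixedPoly F S →+* RatFun F n) := by
    refine ringHom_ext (fun c => ?_) ?_
    · have h := hφ (algebraMap F (LinearQuot z) c)
      rw [← IsScalarTower.algebraMap_apply, ev.commutes] at h
      simpa [chartHom, pointHom] using h
    rintro (i | j)
    · have h2 := congrArg φ (zInv_mul_zClass i)
      rw [map_mul, hφ, hev, map_one] at h2
      simpa [chartHom, pointHom] using eq_inv_of_mul_eq_one_left h2
    · simp [chartHom, pointHom, hφ, hev]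
  intro g hg
  have h := RingHom.congr_fun hcomp g
  rw [RingHom.comp_apply, RingHom.coe_coe, RingHom.mem_ker.1 hg, map_zero] at h
  exact h.symm

end ReciprocalPlane

end

theorem mainTheorem3 {F : Type*} [Field F] {n m : ℕ}
    (z : Fin m → Module.Dual F (Fin n → F)) (hz : ∀ i, z i ≠ 0)
    (V : Submodule F (Fin n → F)) (hV : ReciprocalPlane.IsSpecial z V) :
    RingHom.ker (ReciprocalPlane.chartHom z (ReciprocalPlane.flat z V)) =
        ReciprocalPlane.mixedIdeal z (ReciprocalPlane.flat z V) ∧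
      ∀ T ⊆ ReciprocalPlane.flat z V,
        IsReduced (ReciprocalPlane.ChartRing z (ReciprocalPlane.flat z V) T) := by
  refine ⟨le_antisymm ((ReciprocalPlane.ker_chartHom_le hz).trans
    (ReciprocalPlane.ker_pointHom_top hz).le) ReciprocalPlane.mixedIdeal_le_ker_chartHom, ?_⟩
  intro T _
  have := ReciprocalPlane.isPrime_mixedIdeal (S := ReciprocalPlane.flat z V) hz
  exact isReduced_localizationPreserves
    (ReciprocalPlane.innerMonoid z (ReciprocalPlane.flat z V) T)
    (ReciprocalPlane.ChartRing z (ReciprocalPlane.flat z V) T) inferInstance
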